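/- Let $(V,\otimes,k)$ be a commutative quantale with internal hom $[-,-]$. An $(L,V)$-category $(X,a)$ (a $V$-multicategory) is a set $X$ with a map $a$ assigning to each finite list $\underline x$ in $X$ and each $y\in X$ an element $a(\underline x,y)\in V$, such that $k\le a((x),x)$ and $\bigotimes_i a(\underline x_i,y_i)\otimes a((y_1,\dots,y_n),z)\le a((\underline x_1;\dots;\underline x_n),z)$, where $(\,;\,)$ denotes concatenation. An $(L,V)$-functor $f:(X,a)\to(Y,b)$ is a map with $a((x_1,\dots,x_n),y)\le b((f(x_1),\dots,f(x_n)),f(y))$; it is fully faithful if equality always holds. These form the category $V\text{-}\mathrm{Multi}$. A $V$-quantale $Q$ is a separated cocomplete monoidal $V$-category whose multiplication $*$ is cocontinuous in each variable; it is regarded as an $(L,V)$-category by $Q((q_1,\dots,q_n),w)=Q(q_1*\dots*q_n,w)$ (the unit of $Q$ being used for the empty list). A promonoidal $V$-category $(X,a,P,J)$ is a monoid in the monoidal category of $V$-categories and $V$-distributors; it is regarded as an $(L,V)$-category by $a_0=J$, $a_1=a$, $a_2=P$, $a_n=P\cdot(\mathrm{Id}\boxtimes a_{n-1})$. A $V$-prequantum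 B-algebra is a promonoidal $V$-category with two operations $\rhd,\lhd$ such that $P(z,x,y)=a(z,x\rhd y)$ and $P(x,z,y)=a(z,x\lhd y)$. The $V$-prequantum B-algebras form a full subcategory $V\text{-}\mathrm{PQBalg}$ of $V\text{-}\mathrm{Multi}$. In a full subcategory of $V\text{-}\mathrm{Multi}$, an object $E$ is injective if for all morphisms $i:Y\to Z$ and $g:Y\to E$ with $i$ fully faithful there is $h:Z\to E$ with $hi=g$. An injective hull of $Y$ is a fully faithful morphism $e:Y\to E$ with $E$ injective such that, for every morphism $f$ out of $E$, if $fe$ is fully faithful then so is $f$. For an $(L,V)$-category $(X,a)$ let $\mathbb D_L(X)$ be the set of all maps $\varphi$ from finite lists in $X$ to $V$ with $\bigotimes_i a(\underline x_i,z_i)\otimes\varphi(z_1,\dots,z_n)\le\varphi(\underline x_1;\dots;\underline x_n)$, with the $(L,V)$-structure $$\mathbb D_L(X)[(f_1,\dots,f_n),g]=\bigwedge_{(\underline x_1,\dots,\underline x_n)}[f_1(\underline x_1)\otimes\dots\otimes f_n(\underline x_n),\,g(\underline x_1;\dots;\underline x_n)],$$ which is the one of a $V$-quantale with implications $(f\rhd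 g)(\underline u)=\bigwedge_{\underline v}[f(\underline v),g(\underline u;\underline v)]$ and $(f\lhd g)(\underline u)=\bigwedge_{\underline v}[f(\underline v),g(\underline v;\underline u)]$. Let $X_{\mathbb D_L(X)}$ be the smallest subset of $\mathbb D_L(X)$ that contains all $a(-,x)$, $x\in X$, and is closed under $\rhd$ and $\lhd$, with the restricted $(L,V)$-structure. **Theorem.** Let $C$ be a full subcategory of $V\text{-}\mathrm{Multi}$ that contains all $V$-quantales, and let $(X,a)$ be an object of $C$. Then $(X,a)$ admits an injective hull in $C$. More precisely, $X_{\mathbb D_L(X)}$ is a $V$-prequantum B-algebra, it admits an injective hull in $V\text{-}\mathrm{PQBalg}$, and for every injective hull $e:X_{\mathbb D_L(X)}\to\tilde X$ in $V\text{-}\mathrm{PQBalg}$ the object $\tilde X$ lies in $C$ and the composite of the Yoneda embedding $X\to X_{\mathbb D_L(X)}$, $x\mapsto a(-,x)$, with $e$ is an injective hull of $(X,a)$ in $C$. -/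

import Mathlib

universe u

open CategoryTheory

namespace LV

/-! ### Lists and the internal hom of a commutative quantale

`V` is a commutative quantale: `CommMonoid V`, `CompleteLattice V`, `IsQuantale V`, with
`⊗ = *` and `k = 1`. -/

section Basic

set_option linter.unusedSectionVars false

variable {V : Type u} [CommMonoid V] [CompleteLattice V] [IsQuantale V]

/-- The internal hom `[v, w]` of `V`, the right adjoint of `- ⊗ v`. -/
def ihom (v w : V) : V := Quantale.leftMulResiduation v w

theorem le_ihom {u v w : V} : u ≤ ihom v w ↔ u * v ≤ w :=
  Quantale.leftMulResiduation_le_iff_mul_le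

/-- The extension of the list functor to `V`-relations:
`(Lr)((x₁,…,xₙ),(y₁,…,yₙ)) = r(x₁,y₁) ⊗ … ⊗ r(xₙ,yₙ)`, and `⊥` if the lengths differ. -/
def listRel {X Y : Type u} (r : X → Y → V) : List X → List Y → V
  | [], [] => 1
  | x :: xs, y :: ys => r x y * listRel r xs ys
  | [], _ :: _ => ⊥
  | _ :: _, [] => ⊥

theorem listRel_append {X Y : Type u} (r : X → Y → V) (xs xs' : List X) (ys : List Y) :
    listRel r (xs ++ xs') ys =
      listRel r xs (ys.take xs.length) * listRel r xs' (ys.drop xs.length) := by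
  induction xs generalizing ys with
  | nil => simp [listRel]
  | cons x xs ih =>
    cases ys with
    | nil => simp [listRel, Quantale.bot_mul]
    | cons y ys => simp [listRel, ih, mul_assoc]

theorem listRel_append_append {X Y : Type u} (r : X → Y → V) {xs xs' : List X}
    {ys ys' : List Y} (h : xs.length = ys.length) :
    listRel r (xs ++ xs') (ys ++ ys') = listRel r xs ys * listRel r xs' ys' := by
  rw [listRel_append, h, List.take_left', List.drop_left'] <;> rfl

theorem listRel_eq_bot {X Y : Type u} (r : X → Y → V) {xs : List X} {ys : List Y}
    (h : xs.length ≠ ys.length) : listRel r xs ys = ⊥ := by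
  induction xs generalizing ys with
  | nil => cases ys <;> simp_all [listRel]
  | cons x xs ih =>
    cases ys with
    | nil => rfl
    | cons y ys =>
      have : xs.length ≠ ys.length := by simpa using h
      simp [listRel, ih this, Quantale.mul_bot]

theorem listRel_map {X Y X' Y' : Type u} (r : X' → Y' → V) (f : X → X') (g : Y → Y')
    (xs : List X) (ys : List Y) :
    listRel r (xs.map f) (ys.map g) = listRel (fun x y => r (f x) (g y)) xs ys := by
  induction xs generalizing ys with
  | nil => cases ys <;> rfl
  | cons x xs ih => cases ys <;> simp [listRel, ih]

theorem listRel_swap {X Y : Type u} (r : X → Y → V) (xs : List X) (ys : List Y) :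
    listRel (fun y x => r x y) ys xs = listRel r xs ys := by
  induction xs generalizing ys with
  | nil => cases ys <;> rfl
  | cons x xs ih => cases ys <;> simp [listRel, ih]

theorem one_le_listRel_singletons {X : Type u} {r : List X → X → V} (h : ∀ x, 1 ≤ r [x] x)
    (v : List X) : 1 ≤ listRel r (v.map fun x => [x]) v := by
  induction v with
  | nil => simp [listRel]
  | cons x v ih => simpa [listRel] using mul_le_mul' (h x) ih

theorem flatten_singletons {X : Type u} (v : List X) : (v.map fun x => [x]).flatten = v := by
  induction v with
  | nil => rfl
  | cons x v ih => simp [ih]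

end Basic

/-! ### `V`-categories and `V`-quantales -/

/-- A `V`-category. -/
structure VCat (V : Type u) [CommMonoid V] [CompleteLattice V] where
  carrier : Type u
  hom : carrier → carrier → V
  id_le : ∀ x, 1 ≤ hom x x
  comp_le : ∀ x y z, hom x y * hom y z ≤ hom x z

section VCategories

variable {V : Type u} [CommMonoid V] [CompleteLattice V] [IsQuantale V]

/-- `f` is a `V`-functor. -/
def IsVFunctor (X Y : VCat V) (f : X.carrier → Y.carrier) : Prop :=
  ∀ x x', X.hom x x' ≤ Y.hom (f x) (f x')

/-- `j` is a `V`-distributor from `X` to `Z`: `j · a ≤ j` and `c · j ≤ j`. -/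
def IsVDistributor (X Z : VCat V) (j : X.carrier → Z.carrier → V) : Prop :=
  (∀ x x' z, X.hom x x' * j x' z ≤ j x z) ∧ (∀ x z z', j x z * Z.hom z z' ≤ j x z')

/-- `g : Z → Y` is the colimit of `f : X → Y` weighted by `j : X ⇸ Z`. -/
def IsWeightedColimit {X Z Y : VCat V} (j : X.carrier → Z.carrier → V)
    (f : X.carrier → Y.carrier) (g : Z.carrier → Y.carrier) : Prop :=
  ∀ z y, Y.hom (g z) y = ⨅ x, ihom (j x z) (Y.hom (f x) y)

/-- All weighted colimits exist in `Y`. -/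
def IsCocomplete (Y : VCat V) : Prop :=
  ∀ (X Z : VCat V) (j : X.carrier → Z.carrier → V) (f : X.carrier → Y.carrier),
    IsVDistributor X Z j → IsVFunctor X Y f →
      ∃ g : Z.carrier → Y.carrier, IsVFunctor Z Y g ∧ IsWeightedColimit j f g

/-- `h : Y → W` preserves all weighted colimits that exist in `Y`. -/
def IsCocontinuous (Y W : VCat V) (h : Y.carrier → W.carrier) : Prop :=
  ∀ (X Z : VCat V) (j : X.carrier → Z.carrier → V) (f : X.carrier → Y.carrier)
    (g : Z.carrier → Y.carrier), IsVDistributor X Z j → IsVFunctor X Y f → IsVFunctor Z Y g →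
      IsWeightedColimit j f g → IsWeightedColimit (Y := W) j (h ∘ f) (h ∘ g)

/-- `X` is separated: isomorphic objects are equal. -/
def IsSeparated (X : VCat V) : Prop :=
  ∀ x y, 1 ≤ X.hom x y → 1 ≤ X.hom y x → x = y

end VCategories

/-- A `V`-quantale: a separated cocomplete monoidal `V`-category whose multiplication is
cocontinuous in each variable. -/
structure VQuantale (V : Type u) [CommMonoid V] [CompleteLattice V] [IsQuantale V] extends
    VCat V where
  monoid : Monoid carrier
  mul_functor : ∀ x x' y y', hom x y * hom x' y' ≤ hom (x * x') (y * y')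
  separated : IsSeparated toVCat
  cocomplete : IsCocomplete toVCat
  cocontinuous_left : ∀ q : carrier, IsCocontinuous toVCat toVCat (fun x => q * x)
  cocontinuous_right : ∀ q : carrier, IsCocontinuous toVCat toVCat (fun x => x * q)

/-! ### `(L,V)`-categories -/

/-- An `(L,V)`-category: `e° ≤ a` and `a ∘ a ≤ a`, where the Kleisli composite is
`(a ∘ a)(w, z) = ⋁ (La)(ls, ys) ⊗ a(ys, z)` over all `ys` and all `ls` with `ls.flatten = w`. -/
structure LVCat (V : Type u) [CommMonoid V] [CompleteLattice V] [IsQuantale V] where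
  carrier : Type u
  hom : List carrier → carrier → V
  id_le : ∀ x, 1 ≤ hom [x] x
  comp_le : ∀ (ls : List (List carrier)) (ys : List carrier) (z : carrier),
    listRel hom ls ys * hom ys z ≤ hom ls.flatten z

section LVCategories

variable {V : Type u} [CommMonoid V] [CompleteLattice V] [IsQuantale V]

/-- An `(L,V)`-functor. -/
@[ext]
structure LVFunctor (X Y : LVCat V) where
  toFun : X.carrier → Y.carrier
  map_le : ∀ l x, X.hom l x ≤ Y.hom (l.map toFun) (toFun x)

/-- The category of `(L,V)`-categories and `(L,V)`-functors. -/
instance : Category (LVCat V) where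
  Hom X Y := LVFunctor X Y
  id X := ⟨fun x => x, fun l x => by simp⟩
  comp f g := ⟨fun x => g.toFun (f.toFun x), fun l x => by
    have h := (f.map_le l x).trans (g.map_le (l.map f.toFun) (f.toFun x))
    simpa [List.map_map, Function.comp_def] using h⟩

/-- The class of fully faithful `(L,V)`-functors. -/
def fullyFaithful (V : Type u) [CommMonoid V] [CompleteLattice V] [IsQuantale V] :
    MorphismProperty (LVCat V) :=
  fun X Y f => ∀ (l : List X.carrier) (x : X.carrier),
    X.hom l x = Y.hom (l.map (LVFunctor.toFun f)) (LVFunctor.toFun f x)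

/-- The `(L,V)`-category of a `V`-quantale: `Q((q₁,…,qₙ), w) = Q(q₁ ∗ … ∗ qₙ, w)`, with the unit
for the empty list. -/
def VQuantale.toLVCat (Q : VQuantale V) : LVCat V :=
  letI := Q.monoid
  { carrier := Q.carrier
    hom := fun l y => Q.hom l.prod y
    id_le := fun x => by simpa using Q.id_le x
    comp_le := fun ls ys z => by
      have key : listRel (fun (l : List Q.carrier) y => Q.hom l.prod y) ls ys
          ≤ Q.hom ls.flatten.prod ys.prod := by
        induction ls generalizing ys with
        | nil => cases ys with
          | nil => simpa [listRel] using Q.id_le 1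
          | cons y ys => simp [listRel]
        | cons l ls ih => cases ys with
          | nil => simp [listRel]
          | cons y ys =>
            simp only [listRel, List.flatten_cons, List.prod_append, List.prod_cons]
            exact (mul_le_mul_right (ih ys) _).trans (Q.mul_functor _ _ _ _)
      exact (mul_le_mul_left key _).trans (Q.comp_le _ _ _) }

/-- The full subobject of `X` on a set of elements, with the restricted structure. -/
def LVCat.restrict (X : LVCat V) (S : X.carrier → Prop) : LVCat V where
  carrier := {x : X.carrier // S x}
  hom l x := X.hom (l.map Subtype.val) x.1
  id_le x := X.id_le x.1
  comp_le ls ys z := by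
    have h := X.comp_le (ls.map (List.map Subtype.val)) (ys.map Subtype.val) z.1
    rw [listRel_map] at h
    simpa [List.map_flatten] using h

end LVCategories

/-! ### Injective hulls -/

section Hulls

universe v w

variable {𝒞 : Type w} [Category.{v} 𝒞]

/-- `E` is injective with respect to the class `J`. -/
def IsInjective (J : MorphismProperty 𝒞) (E : 𝒞) : Prop :=
  ∀ ⦃Y Z : 𝒞⦄ (i : Y ⟶ Z) (g : Y ⟶ E), J i → ∃ h : Z ⟶ E, i ≫ h = g

/-- `e` is essential with respect to the class `J`. -/
def IsEssential (J : MorphismProperty 𝒞) {Y E : 𝒞} (e : Y ⟶ E) : Prop :=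
  ∀ ⦃X : 𝒞⦄ (f : E ⟶ X), J (e ≫ f) → J f

/-- `e : Y ⟶ E` exhibits `E` as an injective hull of `Y` with respect to the class `J`. -/
def IsInjectiveHull (J : MorphismProperty 𝒞) {Y E : 𝒞} (e : Y ⟶ E) : Prop :=
  J e ∧ IsInjective J E ∧ IsEssential J e

end Hulls

section FullSubcategories

variable {V : Type u} [CommMonoid V] [CompleteLattice V] [IsQuantale V]

/-- The fully faithful `(L,V)`-functors in a full subcategory of the category of
`(L,V)`-categories. -/
def fullyFaithfulIn (C : ObjectProperty (LVCat V)) : MorphismProperty C.FullSubcategory :=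
  (fullyFaithful V).inverseImage C.ι

end FullSubcategories

/-! ### `V`-prequantum B-algebras -/

/-- A promonoidal `V`-category: a monoid `(X, a, P, J)` in the monoidal category of
`V`-distributors. -/
structure PromonoidalVCat (V : Type u) [CommMonoid V] [CompleteLattice V] extends VCat V where
  P : carrier → carrier → carrier → V
  J : carrier → V
  P_left : ∀ x x' y y' z, (hom x x' * hom y y') * P x' y' z ≤ P x y z
  P_right : ∀ x y z z', P x y z * hom z z' ≤ P x y z'
  J_right : ∀ z z', J z * hom z z' ≤ J z'
  assoc : ∀ b c d e, (⨆ x, P b c x * P x d e) = ⨆ x, P b x e * P c d x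
  J_P : ∀ x w, (⨆ z, J z * P z x w) = hom x w
  P_J : ∀ x w, (⨆ z, J z * P x z w) = hom x w

/-- The `(L,V)`-structure `ã` of a promonoidal `V`-category: `a₀ = J`, `a₁ = a`, `a₂ = P`,
`aₙ = P · (Id ⊠ aₙ₋₁)`. -/
def PromonoidalVCat.multiHom {V : Type u} [CommMonoid V] [CompleteLattice V]
    (X : PromonoidalVCat V) : List X.carrier → X.carrier → V
  | [], y => X.J y
  | [x], y => X.hom x y
  | [x, x'], y => X.P x x' y
  | x :: x' :: x'' :: l, y => ⨆ c, X.multiHom (x' :: x'' :: l) c * X.P x c y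

/-- A `V`-prequantum B-algebra: a promonoidal `V`-category whose `P` is representable by two
implications, `rimp x y = x ▷ y` and `limp x y = x ◁ y`. -/
structure PrequantumBAlgebra (V : Type u) [CommMonoid V] [CompleteLattice V] extends
    PromonoidalVCat V where
  rimp : carrier → carrier → carrier
  limp : carrier → carrier → carrier
  P_limp : ∀ x y z, P x z y = hom z (limp x y)
  P_rimp : ∀ x y z, P z x y = hom z (rimp x y)

section Prequantum

variable {V : Type u} [CommMonoid V] [CompleteLattice V] [IsQuantale V]

/-- The `(L,V)`-categories that come from `V`-prequantum B-algebras. These are the objects of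
the full subcategory of `V`-prequantum B-algebras. -/
def IsPrequantumBAlgebra : ObjectProperty (LVCat V) := fun X =>
  ∃ (A : PrequantumBAlgebra V) (h : A.carrier ≃ X.carrier),
    ∀ (l : List A.carrier) (y : A.carrier), X.hom (l.map h) (h y) = A.multiHom l y

end Prequantum

/-! ### Presheaves -/

section Presheaves

variable {V : Type u} [CommMonoid V] [CompleteLattice V] [IsQuantale V]

/-- The elements of `𝔻_L(X)`: the `(L,V)`-distributors `φ` from `X` to the one-point
`(L,V)`-category `E` (equivalently the `(L,V)`-functors `Xᵒᵖ ⊠ E → V`). The condition is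
`φ ∘ a ≤ φ`; the condition `e° ∘ φ ≤ φ` is void. -/
structure Presheaf (X : LVCat V) where
  val : List X.carrier → V
  act_le : ∀ (ls : List (List X.carrier)) (zs : List X.carrier),
    listRel X.hom ls zs * val zs ≤ val ls.flatten

/-- `𝔻_L(X)[(f₁,…,fₙ), g] = ⋀ [f₁(x₁) ⊗ … ⊗ fₙ(xₙ), g(x₁;…;xₙ)]`, over all lists of lists
`(x₁,…,xₙ)`; lists of lists of another length contribute `[⊥, -] = ⊤`. -/
def presheafHom (X : LVCat V) (fs : List (Presheaf X)) (g : Presheaf X) : V :=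
  ⨅ ls : List (List X.carrier),
    ihom (listRel (fun (f : Presheaf X) l => f.val l) fs ls) (g.val ls.flatten)

theorem presheafHom_mul_le {X : LVCat V} (fs : List (Presheaf X)) (g : Presheaf X)
    (ls : List (List X.carrier)) :
    presheafHom X fs g * listRel (fun (f : Presheaf X) l => f.val l) fs ls
      ≤ g.val ls.flatten :=
  le_ihom.1 (iInf_le _ ls)

theorem presheafHom_list {X : LVCat V} (Fs : List (List (Presheaf X)))
    (gs : List (Presheaf X)) (ls : List (List X.carrier)) :
    ∃ ms : List (List X.carrier), ms.flatten = ls.flatten ∧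
      listRel (presheafHom X) Fs gs * listRel (fun (f : Presheaf X) l => f.val l) Fs.flatten ls
        ≤ listRel (fun (f : Presheaf X) l => f.val l) gs ms := by
  induction Fs generalizing gs ls with
  | nil =>
    cases gs with
    | nil => exact ⟨ls, rfl, by simp [listRel]⟩
    | cons g gs => exact ⟨ls, rfl, by simp [listRel, Quantale.bot_mul]⟩
  | cons F Fs ih =>
    cases gs with
    | nil => exact ⟨ls, rfl, by simp [listRel, Quantale.bot_mul]⟩
    | cons g gs =>
      obtain ⟨ms, hms, h⟩ := ih gs (ls.drop F.length)
      refine ⟨(ls.take F.length).flatten :: ms, ?_, ?_⟩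
      · rw [List.flatten_cons, hms, ← List.flatten_append, List.take_append_drop]
      · rw [List.flatten_cons, listRel_append, listRel, listRel, mul_mul_mul_comm]
        exact mul_le_mul' (presheafHom_mul_le F g _) h

/-- The `(L,V)`-category `𝔻_L(X)` of presheaves on `X`. -/
def presheafLVCat (X : LVCat V) : LVCat V where
  carrier := Presheaf X
  hom := presheafHom X
  id_le g := by
    refine le_iInf fun ls => le_ihom.2 ?_
    rcases ls with _ | ⟨l, _ | ⟨m, ls⟩⟩ <;> simp [listRel, Quantale.mul_bot]
  comp_le Fs gs h := by
    refine le_iInf fun ls => le_ihom.2 ?_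
    obtain ⟨ms, hms, hle⟩ := presheafHom_list Fs gs ls
    rw [mul_right_comm, mul_comm, ← hms]
    exact (mul_le_mul_right hle _).trans (presheafHom_mul_le gs h ms)

/-- The presheaf `a(-, x)`. -/
def yonedaObj (X : LVCat V) (x : X.carrier) : Presheaf X where
  val l := X.hom l x
  act_le ls zs := X.comp_le ls zs x

/-- The right implication `f ▷ g` of the `V`-quantale `𝔻_L(X)`, the right adjoint of `- ∗ f`,
where `(f ∗ g)(w) = ⋁ f(u) ⊗ g(v)` over all decompositions `w = (u;v)`:
`(f ▷ g)(u) = ⋀ [f(v), g(u;v)]`. -/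
def presheafRimp {X : LVCat V} (f g : Presheaf X) : Presheaf X where
  val l := ⨅ v : List X.carrier, ihom (f.val v) (g.val (l ++ v))
  act_le ls zs := by
    refine le_iInf fun v => le_ihom.2 ?_
    by_cases hl : ls.length = zs.length
    swap
    · simp [listRel_eq_bot _ hl, Quantale.bot_mul]
    have h := g.act_le (ls ++ v.map fun x => [x]) (zs ++ v)
    rw [listRel_append_append _ hl, List.flatten_append, flatten_singletons] at h
    refine le_trans ?_ h
    rw [mul_assoc]
    refine mul_le_mul' ?_ (le_ihom.1 (iInf_le _ v))
    simpa using mul_le_mul_right (one_le_listRel_singletons X.id_le v) (listRel X.hom ls zs)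

/-- The left implication `f ◁ g` of the `V`-quantale `𝔻_L(X)`, the right adjoint of `f ∗ -`:
`(f ◁ g)(v) = ⋀ [f(u), g(u;v)]`. -/
def presheafLimp {X : LVCat V} (f g : Presheaf X) : Presheaf X where
  val l := ⨅ v : List X.carrier, ihom (f.val v) (g.val (v ++ l))
  act_le ls zs := by
    refine le_iInf fun v => le_ihom.2 ?_
    have h := g.act_le ((v.map fun x => [x]) ++ ls) (v ++ zs)
    rw [listRel_append_append _ (by simp), List.flatten_append, flatten_singletons] at h
    refine le_trans ?_ h
    rw [mul_assoc]
    refine mul_le_mul' ?_ (le_ihom.1 (iInf_le _ v))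
    simpa using mul_le_mul_left (one_le_listRel_singletons X.id_le v) (listRel X.hom ls zs)

/-- `f ▷ -` is right adjoint to multiplication by `f` from the right. -/
theorem presheafHom_rimp {X : LVCat V} (l : List (Presheaf X)) (f g : Presheaf X) :
    presheafHom X (l ++ [f]) g = presheafHom X l (presheafRimp f g) := by
  apply le_antisymm
  · refine le_iInf fun ls => le_ihom.2 (le_iInf fun v => le_ihom.2 ?_)
    by_cases hl : l.length = ls.length
    · have h := presheafHom_mul_le (l ++ [f]) g (ls ++ [v])
      rw [listRel_append_append _ hl] at h
      simpa [listRel, mul_assoc] using h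
    · simp [listRel_eq_bot _ hl, Quantale.bot_mul, Quantale.mul_bot]
  · refine le_iInf fun ls => le_ihom.2 ?_
    rw [listRel_append, ← mul_assoc]
    refine (mul_le_mul_left (presheafHom_mul_le l (presheafRimp f g) _) _).trans ?_
    conv_rhs => rw [← List.take_append_drop l.length ls, List.flatten_append]
    rcases ls.drop l.length with _ | ⟨v, _ | ⟨w, vs⟩⟩
    · simp [listRel, Quantale.mul_bot]
    · simpa [listRel, presheafRimp] using le_ihom.1 (iInf_le (fun v => ihom (f.val v)
        (g.val ((ls.take l.length).flatten ++ v))) v)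
    · simp [listRel, Quantale.mul_bot]

/-- `f ◁ -` is right adjoint to multiplication by `f` from the left. -/
theorem presheafHom_limp {X : LVCat V} (l : List (Presheaf X)) (f g : Presheaf X) :
    presheafHom X (f :: l) g = presheafHom X l (presheafLimp f g) := by
  apply le_antisymm
  · refine le_iInf fun ls => le_ihom.2 (le_iInf fun v => le_ihom.2 ?_)
    have h := presheafHom_mul_le (f :: l) g (v :: ls)
    simpa [listRel, mul_assoc, mul_comm, mul_left_comm] using h
  · refine le_iInf fun ls => le_ihom.2 ?_
    cases ls with
    | nil => simp [listRel, Quantale.mul_bot]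
    | cons v ls =>
      rw [listRel, mul_left_comm, mul_comm]
      refine (mul_le_mul_left (presheafHom_mul_le l (presheafLimp f g) ls) _).trans ?_
      simpa [presheafLimp] using
        le_ihom.1 (iInf_le (fun v => ihom (f.val v) (g.val (v ++ ls.flatten))) v)

/-- The smallest set of elements of `𝔻_L(X)` that contains the image of the Yoneda embedding
and is closed under both implications. -/
inductive Generated (X : LVCat V) : Presheaf X → Prop
  | yoneda (x : X.carrier) : Generated X (yonedaObj X x)
  | rimp {f g : Presheaf X} : Generated X f → Generated X g → Generated X (presheafRimp f g)
  | limp {f g : Presheaf X} : Generated X f → Generated X g → Generated X (presheafLimp f g)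

/-- The `V`-prequantum B-algebra generated by the image of the Yoneda embedding in `𝔻_L(X)`,
as an `(L,V)`-category. -/
def generatedAlgebra (X : LVCat V) : LVCat V :=
  (presheafLVCat X).restrict (Generated X)

/-- The Yoneda embedding of `X` into `𝔻_L(X)`, with values in the generated algebra. -/
def yonedaGenerated (X : LVCat V) : X ⟶ generatedAlgebra X :=
  LVFunctor.mk (X := X) (Y := generatedAlgebra X)
    (fun x => ⟨yonedaObj X x, Generated.yoneda x⟩)
    (fun l x => by
      refine le_iInf fun ls => le_ihom.2 ?_
      have h : listRel (fun (f : Presheaf X) m => f.val m)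
          (l.map fun x => yonedaObj X x) ls = listRel X.hom ls l := by
        have h1 := listRel_map (fun (f : Presheaf X) m => f.val m) (yonedaObj X) id l ls
        rw [List.map_id] at h1
        exact h1.trans (listRel_swap X.hom ls l)
      have h2 : ((l.map fun x => (⟨yonedaObj X x, Generated.yoneda x⟩ :
          (generatedAlgebra X).carrier)).map Subtype.val) = l.map fun x => yonedaObj X x := by
        rw [List.map_map]; rfl
      erw [h2, h, mul_comm]
      exact X.comp_le ls l x)

end Presheaves

end LV

open LV

/-!
The injective hull is a Dedekind–MacNeille completion, and it can be written down for every
`(L,V)`-category `X`. An upper bound of a presheaf `g` on `X` is a triple `(u, v, x)` with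
`g(w) ≤ a((u; w; v), x)` for all `w`, taken with its truth value in `V` (`upperBound`). The
presheaves that are determined by their upper bounds are called closed. They contain the
representable ones and are stable under residuation by arbitrary presheaves, so the closure
operator is a nucleus and the closed presheaves form a `V`-quantale `closedQuantale X`; its
multihom is the one of `𝔻_L(X)`, which through the Yoneda lemma yields the monoid laws.

Three facts carry the theorem.

* A `V`-quantale is injective (`VQuantale.exists_extension`): along a fully faithful `i : Y ⟶ Z`,
  a morphism `g` extends by the colimit of the products `g(y₁) ∗ … ∗ g(yₙ)` weighted by
  `Z((i(y₁),…,i(yₙ)), -)`.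
* The embedding of `X` into the closed presheaves is essential
  (`fullyFaithful_of_comp_yoneda_closed`). Values and upper bounds of `g` are both multimorphisms
  that involve `g` and elements of `X` only, so every morphism preserves them, and composing them
  in the target bounds its homs by those of `X`. By density of the Yoneda embedding
  (`fullyFaithful_of_yonedaRestrict`), homs into `g` from lists in `X` suffice.
* The embedding of `X` into the generated algebra is essential as well
  (`fullyFaithful_of_comp_yonedaGenerated`), by induction on the generation of its elements.

The first two make `closedQuantale X` an injective hull of `X` in each full subcategory that
contains the `V`-quantales. The `V`-prequantum B-algebras form such a subcategory
(`VQuantale.isPrequantumBAlgebra`), and the generated algebra lies in it. Injective hulls being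
unique, every hull there is isomorphic to a `V`-quantale, hence equal to one by transport of
structure; so it belongs to `C` and is injective in it. It remains to see that the composite is
essential with respect to arbitrary targets `W` in `C`, and for this `W` can be replaced by the
`V`-quantale `closedQuantale W` in which it embeds.
-/

namespace LV

/-! ### Residuation in `V` and in `V`-categories -/

section Residuation

set_option linter.unusedSectionVars false

variable {V : Type u} [CommMonoid V] [CompleteLattice V] [IsQuantale V]

theorem le_iInf_ihom {ι : Sort*} {t : V} {j r : ι → V} :
    t ≤ ⨅ x, ihom (j x) (r x) ↔ ∀ x, t * j x ≤ r x := by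
  simp only [le_iInf_iff, le_ihom]

/-- The Yoneda lemma for a separated `V`-category: an object is determined by the functor it
corepresents. -/
theorem IsSeparated.eq_of_hom_eq {Y : VCat V} (hY : IsSeparated Y) {x y : Y.carrier}
    (h : ∀ z, Y.hom x z = Y.hom y z) : x = y :=
  hY x y ((Y.id_le y).trans (h y).ge) ((Y.id_le x).trans (h x).le)

theorem IsWeightedColimit.le_hom_iff {X Z Y : VCat V} {j : X.carrier → Z.carrier → V}
    {f : X.carrier → Y.carrier} {g : Z.carrier → Y.carrier} (h : IsWeightedColimit j f g)
    {t : V} {z : Z.carrier} {y : Y.carrier} :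
    t ≤ Y.hom (g z) y ↔ ∀ x, t * j x z ≤ Y.hom (f x) y := by
  rw [h z y, le_iInf_ihom]

theorem IsWeightedColimit.le_hom {X Z Y : VCat V} {j : X.carrier → Z.carrier → V}
    {f : X.carrier → Y.carrier} {g : Z.carrier → Y.carrier} (h : IsWeightedColimit j f g)
    (x : X.carrier) (z : Z.carrier) : j x z ≤ Y.hom (f x) (g z) := by
  simpa using h.le_hom_iff.1 (Y.id_le (g z)) x

theorem IsWeightedColimit.isVFunctor {X Z Y : VCat V} {j : X.carrier → Z.carrier → V}
    {f : X.carrier → Y.carrier} {g : Z.carrier → Y.carrier} (h : IsWeightedColimit j f g)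
    (hj : IsVDistributor X Z j) : IsVFunctor Z Y g := fun z z' =>
  h.le_hom_iff.2 fun x => by
    rw [mul_comm]
    exact (hj.2 x z z').trans (h.le_hom x z')

/-- The underlying `V`-category of an `(L,V)`-category. -/
abbrev LVCat.toVCat (X : LVCat V) : VCat V where
  carrier := X.carrier
  hom x y := X.hom [x] y
  id_le := X.id_le
  comp_le x y z := by simpa [listRel] using X.comp_le [[x]] [y] z

theorem LVCat.hom_mul_hom_le (X : LVCat V) (l : List X.carrier) (y z : X.carrier) :
    X.hom l y * X.hom [y] z ≤ X.hom l z := by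
  simpa [listRel] using X.comp_le [l] [y] z

end Residuation

/-! ### Implications in a `V`-quantale -/

section Implications

variable {V : Type u} [CommMonoid V] [CompleteLattice V] [IsQuantale V]

/-- In a cocomplete `V`-category, a cocontinuous `V`-functor `h` has a right adjoint: its value
at `y` is the colimit of the identity weighted by `Y(h -, y)`. -/
theorem IsCocontinuous.exists_rightAdjoint {Y : VCat V} (hY : IsCocomplete Y)
    {h : Y.carrier → Y.carrier} (hh : IsVFunctor Y Y h) (hc : IsCocontinuous Y Y h)
    (y : Y.carrier) : ∃ r, ∀ z, Y.hom (h z) y = Y.hom z r := by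
  let I : VCat V := ⟨PUnit, fun _ _ => 1, fun _ => le_rfl, fun _ _ _ => (mul_one _).le⟩
  let j : Y.carrier → I.carrier → V := fun z _ => Y.hom (h z) y
  have hj : IsVDistributor Y I j :=
    ⟨fun x x' _ => (mul_le_mul_left (hh x x') _).trans (Y.comp_le _ _ _),
      fun _ _ _ => (mul_one _).le⟩
  have hid : IsVFunctor Y Y id := fun _ _ => le_rfl
  obtain ⟨g, hg, hcol⟩ := hY Y I j id hj hid
  refine ⟨g PUnit.unit, fun z => le_antisymm (hcol.le_hom z PUnit.unit) ?_⟩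
  -- The counit: `h` preserves the colimit, so `h (g _)` is the colimit of `h` weighted by
  -- `Y(h -, y)`.
  have h1 : 1 ≤ Y.hom (h (g PUnit.unit)) y :=
    (hc Y I j id g hj hid hg hcol).le_hom_iff.2 fun x => (one_mul _).le
  calc Y.hom z (g PUnit.unit) = Y.hom z (g PUnit.unit) * 1 := (mul_one _).symm
    _ ≤ Y.hom (h z) (h (g PUnit.unit)) * Y.hom (h (g PUnit.unit)) y := mul_le_mul' (hh _ _) h1
    _ ≤ Y.hom (h z) y := Y.comp_le _ _ _

variable (Q : VQuantale V)

instance VQuantale.instMonoid : Monoid Q.carrier := Q.monoid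

theorem VQuantale.isVFunctor_mul_left (q : Q.carrier) :
    IsVFunctor Q.toVCat Q.toVCat (fun x => q * x) := fun x x' => by
  simpa using (mul_le_mul_left (Q.id_le q) _).trans (Q.mul_functor q x q x')

theorem VQuantale.isVFunctor_mul_right (q : Q.carrier) :
    IsVFunctor Q.toVCat Q.toVCat (fun x => x * q) := fun x x' => by
  simpa using (mul_le_mul_right (Q.id_le q) _).trans (Q.mul_functor x q x' q)

theorem VQuantale.exists_rimp (x y : Q.carrier) :
    ∃ r, ∀ z, Q.hom (z * x) y = Q.hom z r :=
  (Q.cocontinuous_right x).exists_rightAdjoint Q.cocomplete (Q.isVFunctor_mul_right x) y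

theorem VQuantale.exists_limp (x y : Q.carrier) :
    ∃ r, ∀ z, Q.hom (x * z) y = Q.hom z r :=
  (Q.cocontinuous_left x).exists_rightAdjoint Q.cocomplete (Q.isVFunctor_mul_left x) y

/-- An `(L,V)`-category in which the first and the last variable of a multimorphism can be
residuated comes from a `V`-prequantum B-algebra, with `P(x, y, z) = Y((x, y), z)` and
`J(z) = Y((), z)`. The suprema that compute composites are attained at the implications. -/
theorem isPrequantumBAlgebra_of_residuated (Y : LVCat V)
    (hr : ∀ x y, ∃ r, ∀ l, Y.hom (l ++ [x]) y = Y.hom l r)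
    (hl : ∀ x y, ∃ r, ∀ l, Y.hom (x :: l) y = Y.hom l r) : IsPrequantumBAlgebra Y := by
  choose rimp hr using hr
  choose limp hl using hl
  have hsup : ∀ l y, (⨆ z, Y.hom l z * Y.hom [z] y) = Y.hom l y := fun l y =>
    le_antisymm (iSup_le fun _ => Y.hom_mul_hom_le _ _ _)
      (le_iSup_of_le y (by simpa using mul_le_mul_right (Y.id_le y) (Y.hom l y)))
  have hr' : ∀ x y z, Y.hom [z, x] y = Y.hom [z] (rimp x y) := fun x y z => hr x y [z]
  let A : PrequantumBAlgebra V :=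
    { toVCat := Y.toVCat
      P := fun x y z => Y.hom [x, y] z
      J := fun z => Y.hom [] z
      P_left := fun x x' y y' z => by
        simpa [listRel] using! Y.comp_le [[x], [y]] [x', y'] z
      P_right := fun x y z z' => Y.hom_mul_hom_le _ _ _
      J_right := fun z z' => Y.hom_mul_hom_le _ _ _
      assoc := fun b c d e => by
        calc (⨆ x, Y.hom [b, c] x * Y.hom [x, d] e)
            = ⨆ x, Y.hom [b, c] x * Y.hom [x] (rimp d e) := by simp only [hr']
          _ = Y.hom [b, c, d] e := (hsup _ _).trans (hr d e [b, c]).symm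
          _ = ⨆ x, Y.hom [c, d] x * Y.hom [x] (limp b e) :=
            (hl b e [c, d]).trans (hsup _ _).symm
          _ = ⨆ x, Y.hom [b, x] e * Y.hom [c, d] x := by simp only [hl b e, mul_comm]
      J_P := fun x w => by
        refine Eq.trans (iSup_congr fun z => ?_) ((hsup [] (rimp x w)).trans (hr x w []).symm)
        exact congrArg _ (hr' x w z)
      P_J := fun x w => by
        refine Eq.trans (iSup_congr fun z => ?_) ((hsup [] (limp x w)).trans (hl x w []).symm)
        exact congrArg _ (hl x w [z])
      rimp := rimp
      limp := limp
      P_limp := fun x y z => hl x y [z]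
      P_rimp := fun x y z => hr' x y z }
  have hA : ∀ l y, Y.hom l y = A.multiHom l y := by
    intro l
    induction l with
    | nil => exact fun _ => rfl
    | cons x l ih =>
      intro y
      rcases l with _ | ⟨x', _ | ⟨x'', l⟩⟩
      · rfl
      · rfl
      · rw [hl x y, ← hsup]
        exact iSup_congr fun c => congrArg₂ _ (ih c) (hl x y [c]).symm
  exact ⟨A, Equiv.refl _, fun l y => Eq.trans (congrArg (Y.hom · y) (List.map_id l)) (hA l y)⟩

theorem VQuantale.isPrequantumBAlgebra : IsPrequantumBAlgebra Q.toLVCat := by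
  refine isPrequantumBAlgebra_of_residuated _ (fun x y => ?_) fun x y => ?_
  · obtain ⟨r, hr⟩ := Q.exists_rimp x y
    refine ⟨r, fun (l : List Q.carrier) => Eq.trans ?_ (hr l.prod)⟩
    exact congrArg (Q.hom · y) (List.prod_append.trans (congrArg (l.prod * ·) List.prod_singleton))
  · obtain ⟨r, hr⟩ := Q.exists_limp x y
    exact ⟨r, fun (l : List Q.carrier) => hr l.prod⟩

end Implications

/-! ### Injectivity of `V`-quantales -/

section Injectivity

variable {V : Type u} [CommMonoid V] [CompleteLattice V] [IsQuantale V]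

open Classical in
/-- The discrete `V`-category on a set. -/
noncomputable def discreteVCat (V : Type u) [CommMonoid V] [CompleteLattice V] [IsQuantale V]
    (S : Type u) : VCat V where
  carrier := S
  hom x y := if x = y then 1 else ⊥
  id_le x := by simp
  comp_le x y z := by
    by_cases h : x = y
    · subst h; simp
    · simp [h]

theorem isVDistributor_discreteVCat {S : Type u} {Z : VCat V} {j : S → Z.carrier → V}
    (hj : ∀ x z z', j x z * Z.hom z z' ≤ j x z') :
    IsVDistributor (discreteVCat V S) Z j := by
  refine ⟨fun x x' z => ?_, hj⟩
  classical
  change (if x = x' then 1 else ⊥) * j x' z ≤ j x z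
  split_ifs with h
  · rw [h, one_mul]
  · simp

theorem isVFunctor_discreteVCat {S : Type u} {Y : VCat V} (f : S → Y.carrier) :
    IsVFunctor (discreteVCat V S) Y f := fun x x' => by
  classical
  change (if x = x' then 1 else ⊥) ≤ _
  split_ifs with h
  · exact h ▸ Y.id_le _
  · exact bot_le

/-- Multiplication in a `V`-quantale preserves weighted colimits jointly in finitely many
variables, here for colimits of products of lists. -/
theorem VQuantale.le_hom_prod_of_isWeightedColimit (Q : VQuantale V) {Y : Type u} {Z : VCat V}
    (g : Y → Q.carrier) {j : List Y → Z.carrier → V} {h : Z.carrier → Q.carrier}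
    (hh : IsWeightedColimit (X := discreteVCat V (List Y)) (Y := Q.toVCat) j
      (fun l => (List.map g l).prod) h)
    (zs : List Z.carrier) (t : V) (w : Q.carrier)
    (ht : ∀ ls : List (List Y), t * listRel j ls zs ≤ Q.hom (ls.flatten.map g).prod w) :
    t ≤ Q.hom (zs.map h).prod w := by
  induction zs generalizing t w with
  | nil => simpa [listRel] using ht []
  | cons z zs ih =>
    -- The right implication `r` frees the variable `z`, and the left implication `s` restores the
    -- shape of the goal for the remaining variables.
    obtain ⟨r, hr⟩ := Q.exists_rimp (zs.map h).prod w
    rw [List.map_cons, List.prod_cons, hr]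
    refine hh.le_hom_iff.2 fun (l : List Y) => ?_
    obtain ⟨s, hs⟩ := Q.exists_limp (List.map g l).prod w
    rw [← hr, hs]
    refine ih _ _ fun ls => ?_
    rw [← hs, mul_assoc]
    simpa only [listRel, List.flatten_cons, List.map_append, List.prod_append] using ht (l :: ls)

/-- Along a fully faithful `i : Y ⟶ Z`, a morphism `g` into a `V`-quantale extends by
`z ↦ colim g(y₁) ∗ … ∗ g(yₙ)`, weighted by `Z((i(y₁),…,i(yₙ)), z)`. -/
theorem VQuantale.exists_extension (Q : VQuantale V) {Y Z : LVCat V} (i : Y ⟶ Z)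
    (g : Y ⟶ Q.toLVCat) (hi : fullyFaithful V i) : ∃ h : Z ⟶ Q.toLVCat, i ≫ h = g := by
  let i' : Y.carrier → Z.carrier := LVFunctor.toFun i
  let g' : Y.carrier → Q.carrier := LVFunctor.toFun g
  have hg' : ∀ l y, Y.hom l y ≤ Q.hom (l.map g').prod (g' y) := LVFunctor.map_le g
  have hi' : ∀ l y, Y.hom l y = Z.hom (l.map i') (i' y) := hi
  let j : (discreteVCat V (List Y.carrier)).carrier → Z.toVCat.carrier → V :=
    fun l z => Z.hom (List.map i' l) z
  have hj : IsVDistributor (discreteVCat V (List Y.carrier)) Z.toVCat j :=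
    isVDistributor_discreteVCat fun l z z' => Z.hom_mul_hom_le _ z z'
  obtain ⟨h, -, hh⟩ := Q.cocomplete (discreteVCat V (List Y.carrier)) Z.toVCat j
    (fun l => (List.map g' l).prod) hj (isVFunctor_discreteVCat _)
  refine ⟨LVFunctor.mk (X := Z) (Y := Q.toLVCat) h fun zs z => ?_, ?_⟩
  · refine Q.le_hom_prod_of_isWeightedColimit (Z := Z.toVCat) g' hh zs _ _ fun ls => ?_
    refine le_trans ?_ (hh.le_hom (List.flatten ls) z)
    have := Z.comp_le (List.map (List.map i') ls) zs z
    have h2 := listRel_map Z.hom (List.map i') id ls zs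
    rw [List.map_id] at h2
    rw [h2, ← List.map_flatten, mul_comm] at this
    exact this
  -- On `i(y)` the weight is `Y(-, y)` as `i` is fully faithful, so the colimit is `g(y)`.
  · refine LVFunctor.ext (funext fun y => Q.separated _ _ ?_ ?_)
    · refine hh.le_hom_iff.2 fun l => ?_
      rw [one_mul]
      exact (hi' l y).ge.trans (hg' l y)
    · have h1 := hh.le_hom [y] (i' y)
      refine (Y.id_le y).trans ((hi' [y] y).le.trans (h1.trans (le_of_eq ?_)))
      exact congrArg (Q.hom · (h (i' y))) (mul_one (g' y))

theorem VQuantale.isInjective (Q : VQuantale V) {C : ObjectProperty (LVCat V)}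
    {E : C.FullSubcategory} (hE : E.obj = Q.toLVCat) : IsInjective (fullyFaithfulIn C) E := by
  obtain ⟨E, h⟩ := E
  subst hE
  intro Y Z i g hi
  obtain ⟨h, hh⟩ := Q.exists_extension i.hom g.hom hi
  exact ⟨ObjectProperty.homMk h, ObjectProperty.hom_ext _ hh⟩

end Injectivity

/-! ### Homs of presheaves -/

section PresheafHoms

variable {V : Type u} [CommMonoid V] [CompleteLattice V] [IsQuantale V] {X : LVCat V}

theorem Presheaf.ext {f g : Presheaf X} (h : ∀ w, f.val w = g.val w) : f = g := by
  cases f; cases g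
  congr
  exact funext h

/-- Substitution into the middle of a list. -/
theorem LVCat.listRel_mul_hom_le (X : LVCat V) (u v : List X.carrier)
    (ls : List (List X.carrier)) (zs : List X.carrier) (x : X.carrier) :
    listRel X.hom ls zs * X.hom (u ++ zs ++ v) x ≤ X.hom (u ++ ls.flatten ++ v) x := by
  by_cases hl : ls.length = zs.length
  swap
  · simp [listRel_eq_bot _ hl, Quantale.bot_mul]
  have h := X.comp_le ((u.map fun x => [x]) ++ (ls ++ v.map fun x => [x])) (u ++ (zs ++ v)) x
  rw [listRel_append_append _ (by simp), listRel_append_append _ hl, List.flatten_append,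
    List.flatten_append, flatten_singletons, flatten_singletons, ← List.append_assoc,
    ← List.append_assoc] at h
  refine (mul_le_mul_left ?_ _).trans h
  calc listRel X.hom ls zs = 1 * (listRel X.hom ls zs * 1) := by simp
    _ ≤ _ := mul_le_mul' (one_le_listRel_singletons X.id_le u)
      (mul_le_mul_right (one_le_listRel_singletons X.id_le v) _)

theorem le_presheafHom_iff {t : V} {fs : List (Presheaf X)} {g : Presheaf X} :
    t ≤ presheafHom X fs g ↔ ∀ ls : List (List X.carrier),
      t * listRel (fun (f : Presheaf X) l => f.val l) fs ls ≤ g.val ls.flatten :=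
  le_iInf_ihom

theorem presheafHom_nil (g : Presheaf X) : presheafHom X [] g = g.val [] := by
  refine eq_of_forall_le_iff fun t => le_presheafHom_iff.trans ⟨fun h => ?_, fun h ls => ?_⟩
  · simpa [listRel] using h []
  · cases ls <;> simp [listRel, h, Quantale.mul_bot]

theorem le_presheafHom_singleton_iff {t : V} {f g : Presheaf X} :
    t ≤ presheafHom X [f] g ↔ ∀ w, t * f.val w ≤ g.val w := by
  rw [presheafHom_limp, presheafHom_nil]
  refine le_iInf_ihom.trans (forall_congr' fun w => ?_)
  rw [List.append_nil]

theorem le_presheafHom_pair_iff {t : V} {f g h : Presheaf X} :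
    t ≤ presheafHom X [f, g] h ↔ ∀ u v, t * (f.val u * g.val v) ≤ h.val (u ++ v) := by
  have := presheafHom_rimp [f] g h
  rw [List.singleton_append] at this
  rw [this, le_presheafHom_singleton_iff]
  refine forall_congr' fun u => le_iInf_ihom.trans (forall_congr' fun v => ?_)
  rw [mul_assoc]

/-- The Yoneda lemma for the embedding `x ↦ a(-, x)` into `𝔻_L(X)`. -/
theorem presheafHom_map_yonedaObj (l : List X.carrier) (g : Presheaf X) :
    presheafHom X (l.map (yonedaObj X)) g = g.val l := by
  induction l generalizing g with
  | nil => exact presheafHom_nil g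
  | cons x l ih =>
    rw [List.map_cons, presheafHom_limp, ih]
    refine eq_of_forall_le_iff fun t => le_iInf_ihom.trans ⟨fun h => ?_, fun h v => ?_⟩
    · simpa using (mul_le_mul_right (X.id_le x) t).trans (h [x])
    · have h1 := g.act_le (v :: l.map fun x => [x]) (x :: l)
      rw [List.flatten_cons, flatten_singletons] at h1
      refine le_trans ?_ h1
      rw [mul_comm]
      refine mul_le_mul' ?_ h
      exact (mul_one _).ge.trans (mul_le_mul_right (one_le_listRel_singletons X.id_le l) _)

theorem presheafHom_map_yonedaObj_yonedaObj (l : List X.carrier) (x : X.carrier) :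
    presheafHom X (l.map (yonedaObj X)) (yonedaObj X x) = X.hom l x :=
  presheafHom_map_yonedaObj l _

end PresheafHoms

/-! ### The closure operator on presheaves -/

section Closure

variable {V : Type u} [CommMonoid V] [CompleteLattice V] [IsQuantale V]

/-- For `φ` a `V`-valued predicate on lists in `X`, the degree to which `x` bounds `(u; w; v)`
for all `w` in `φ`. -/
def upperBound (X : LVCat V) (φ : List X.carrier → V) (u v : List X.carrier) (x : X.carrier) :
    V :=
  ⨅ w, ihom (φ w) (X.hom (u ++ w ++ v) x)

theorem le_upperBound_iff {X : LVCat V} {φ : List X.carrier → V} {u v : List X.carrier}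
    {x : X.carrier} {t : V} :
    t ≤ upperBound X φ u v x ↔ ∀ w, t * φ w ≤ X.hom (u ++ w ++ v) x :=
  le_iInf_ihom

/-- The closure of `φ`, as in the Dedekind–MacNeille completion: `w` belongs to it as far as every
upper bound `(u, v, x)` of `φ` is one of `w`. It is a presheaf for arbitrary `φ`. -/
def presheafClosure (X : LVCat V) (φ : List X.carrier → V) : Presheaf X where
  val w := ⨅ c : List X.carrier × List X.carrier × X.carrier,
    ihom (upperBound X φ c.1 c.2.1 c.2.2) (X.hom (c.1 ++ w ++ c.2.1) c.2.2)
  act_le ls zs := by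
    refine le_iInf_ihom.2 fun ⟨u, v, x⟩ => ?_
    rw [mul_assoc]
    exact (mul_le_mul_right (le_iInf_ihom.1 le_rfl (u, v, x)) _).trans
      (X.listRel_mul_hom_le u v ls zs x)

variable {X : LVCat V}

theorem le_presheafClosure_iff {φ : List X.carrier → V} {w : List X.carrier} {t : V} :
    t ≤ (presheafClosure X φ).val w ↔
      ∀ u v x, t * upperBound X φ u v x ≤ X.hom (u ++ w ++ v) x := by
  refine le_iInf_ihom.trans ⟨fun h u v x => h (u, v, x), fun h c => h _ _ _⟩

theorem le_presheafClosure (φ : List X.carrier → V) (w : List X.carrier) :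
    φ w ≤ (presheafClosure X φ).val w :=
  le_presheafClosure_iff.2 fun u v x => by
    rw [mul_comm]
    exact le_upperBound_iff.1 le_rfl w

/-- A presheaf is closed if it is an intersection of the presheaves `w ↦ [c, a((u; w; v), x)]`. -/
def Presheaf.IsClosed (g : Presheaf X) : Prop :=
  ∀ w, (presheafClosure X g.val).val w ≤ g.val w

/-- The elements of a closed presheaf are detected by its upper bounds. -/
theorem Presheaf.isClosed_iff {g : Presheaf X} :
    g.IsClosed ↔ ∀ w t, (∀ u v x c, (∀ w', c * g.val w' ≤ X.hom (u ++ w' ++ v) x) →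
      t * c ≤ X.hom (u ++ w ++ v) x) → t ≤ g.val w := by
  refine ⟨fun hg w t h => le_trans ?_ (hg w), fun h w => h w _ fun u v x c hc => ?_⟩
  · exact le_presheafClosure_iff.2 fun u v x => h u v x _ (le_upperBound_iff.1 le_rfl)
  · exact (mul_le_mul_right (le_upperBound_iff.2 hc) _).trans
      (le_presheafClosure_iff.1 le_rfl u v x)

theorem Presheaf.IsClosed.closure_le {g : Presheaf X} (hg : g.IsClosed)
    {φ : List X.carrier → V} {t : V} (h : ∀ w, t * φ w ≤ g.val w) (w : List X.carrier) :
    t * (presheafClosure X φ).val w ≤ g.val w := by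
  refine Presheaf.isClosed_iff.1 hg w _ fun u v x c hc => ?_
  rw [mul_comm t, mul_assoc]
  refine (mul_le_mul_right (le_upperBound_iff.2 fun w' => ?_) _).trans
    (le_presheafClosure_iff.1 le_rfl u v x)
  rw [mul_comm t, mul_assoc]
  exact (mul_le_mul_right (h w') c).trans (hc w')

theorem le_presheafHom_closure_iff {g : Presheaf X} (hg : g.IsClosed) {φ : List X.carrier → V}
    {t : V} : t ≤ presheafHom X [presheafClosure X φ] g ↔ ∀ w, t * φ w ≤ g.val w :=
  le_presheafHom_singleton_iff.trans
    ⟨fun h w => (mul_le_mul_right (le_presheafClosure φ w) t).trans (h w), hg.closure_le⟩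

theorem isClosed_presheafClosure (φ : List X.carrier → V) : (presheafClosure X φ).IsClosed := by
  refine Presheaf.isClosed_iff.2 fun w t h => le_presheafClosure_iff.2 fun u v x => ?_
  refine h u v x _ fun w' => ?_
  rw [mul_comm]
  exact le_presheafClosure_iff.1 le_rfl u v x

theorem isClosed_yonedaObj (x : X.carrier) : (yonedaObj X x).IsClosed := by
  refine Presheaf.isClosed_iff.2 fun w t h => ?_
  have h1 := h [] [] x 1 fun w' => by simp [yonedaObj]
  rwa [mul_one, List.nil_append, List.append_nil] at h1

/-- Closed presheaves are stable under residuation, so the closure operator is a nucleus. -/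
theorem Presheaf.IsClosed.rimp {g : Presheaf X} (hg : g.IsClosed) (f : Presheaf X) :
    (presheafRimp f g).IsClosed := by
  refine Presheaf.isClosed_iff.2 fun w t h => le_iInf_ihom.2 fun v => ?_
  refine Presheaf.isClosed_iff.1 hg _ _ fun u v' x c hc => ?_
  have := h u (v ++ v') x (f.val v * c) fun w' => ?_
  · simpa [mul_assoc] using this
  · have h1 : (presheafRimp f g).val w' * f.val v ≤ g.val (w' ++ v) := le_iInf_ihom.1 le_rfl v
    have h2 := (mul_le_mul_right h1 c).trans (hc _)
    simpa [mul_comm, mul_left_comm, mul_assoc] using h2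

theorem Presheaf.IsClosed.limp {g : Presheaf X} (hg : g.IsClosed) (f : Presheaf X) :
    (presheafLimp f g).IsClosed := by
  refine Presheaf.isClosed_iff.2 fun w t h => le_iInf_ihom.2 fun u => ?_
  refine Presheaf.isClosed_iff.1 hg _ _ fun u' v x c hc => ?_
  have := h (u' ++ u) v x (f.val u * c) fun w' => ?_
  · simpa [mul_assoc] using this
  · have h1 : (presheafLimp f g).val w' * f.val u ≤ g.val (u ++ w') := le_iInf_ihom.1 le_rfl u
    have h2 := (mul_le_mul_right h1 c).trans (hc _)
    simpa [mul_comm, mul_left_comm, mul_assoc] using h2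

end Closure

/-! ### The `V`-quantale of closed presheaves -/

section ClosedQuantale

set_option linter.unusedSectionVars false

variable {V : Type u} [CommMonoid V] [CompleteLattice V] [IsQuantale V]

/-- The full subobject of `𝔻_L(X)` on the closed presheaves. -/
abbrev closedLVCat (X : LVCat V) : LVCat V :=
  (presheafLVCat X).restrict Presheaf.IsClosed

/-- The closed presheaf generated by `φ`, where `φ` is not assumed to be a presheaf. -/
def closedMk (X : LVCat V) (φ : List X.carrier → V) : (closedLVCat X).carrier :=
  ⟨presheafClosure X φ, isClosed_presheafClosure φ⟩

variable {X : LVCat V}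

/-- The right implication of closed presheaves. -/
def closedRimp (f g : (closedLVCat X).carrier) : (closedLVCat X).carrier :=
  ⟨presheafRimp f.1 g.1, g.2.rimp f.1⟩

/-- The left implication of closed presheaves. -/
def closedLimp (f g : (closedLVCat X).carrier) : (closedLVCat X).carrier :=
  ⟨presheafLimp f.1 g.1, g.2.limp f.1⟩

theorem closed_hom_append_rimp (l : List (closedLVCat X).carrier)
    (f g : (closedLVCat X).carrier) :
    (closedLVCat X).hom (l ++ [f]) g = (closedLVCat X).hom l (closedRimp f g) := by
  have h := presheafHom_rimp (l.map Subtype.val) f.1 g.1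
  refine Eq.trans ?_ h
  exact congrArg (presheafHom X · g.1) List.map_append

theorem closed_hom_cons_limp (l : List (closedLVCat X).carrier)
    (f g : (closedLVCat X).carrier) :
    (closedLVCat X).hom (f :: l) g = (closedLVCat X).hom l (closedLimp f g) :=
  presheafHom_limp (l.map Subtype.val) f.1 g.1

theorem le_hom_closedMk_iff {φ : List X.carrier → V} {g : (closedLVCat X).carrier} {t : V} :
    t ≤ (closedLVCat X).hom [closedMk X φ] g ↔ ∀ w, t * φ w ≤ g.1.val w :=
  le_presheafHom_closure_iff g.2

/-- Multiplication of closed presheaves: the closure of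
`w ↦ ⋁ f(u) ⊗ g(v)` over the decompositions `w = (u; v)`. -/
def closedMul (f g : (closedLVCat X).carrier) : (closedLVCat X).carrier :=
  closedMk X fun w => ⨆ p : {p : List X.carrier × List X.carrier // p.1 ++ p.2 = w},
    f.1.val p.1.1 * g.1.val p.1.2

/-- The unit for `closedMul`: the closure of the empty list. -/
def closedOne (X : LVCat V) : (closedLVCat X).carrier :=
  closedMk X fun
    | [] => 1
    | _ :: _ => ⊥

theorem hom_closedMul (f g h : (closedLVCat X).carrier) :
    (closedLVCat X).hom [closedMul f g] h = (closedLVCat X).hom [f, g] h := by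
  refine eq_of_forall_le_iff fun t => le_hom_closedMk_iff.trans
    (Iff.trans ?_ le_presheafHom_pair_iff.symm)
  simp only [Quantale.mul_iSup_distrib, iSup_le_iff]
  exact ⟨fun H u v => H _ ⟨(u, v), rfl⟩, fun H w ⟨⟨u, v⟩, e⟩ => by subst e; exact H u v⟩

theorem hom_closedOne (g : (closedLVCat X).carrier) :
    (closedLVCat X).hom [closedOne X] g = (closedLVCat X).hom [] g := by
  refine Eq.trans ?_ (presheafHom_nil g.1).symm
  refine eq_of_forall_le_iff fun t => le_hom_closedMk_iff.trans ?_
  refine ⟨fun H => by simpa using H [], fun H w => ?_⟩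
  cases w <;> simp [H]

theorem isSeparated_closedLVCat : IsSeparated (closedLVCat X).toVCat := by
  intro f g hfg hgf
  refine Subtype.ext (Presheaf.ext fun w => le_antisymm ?_ ?_)
  · simpa using le_presheafHom_singleton_iff.1 hfg w
  · simpa using le_presheafHom_singleton_iff.1 hgf w

theorem closed_eq_of_hom_eq {f g : (closedLVCat X).carrier}
    (h : ∀ k, (closedLVCat X).hom [f] k = (closedLVCat X).hom [g] k) : f = g :=
  isSeparated_closedLVCat.eq_of_hom_eq h

theorem hom_closedMul_eq_limp (f g h : (closedLVCat X).carrier) :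
    (closedLVCat X).hom [closedMul f g] h = (closedLVCat X).hom [g] (closedLimp f h) :=
  (hom_closedMul f g h).trans (closed_hom_cons_limp [g] f h)

theorem hom_closedMul_eq_rimp (f g h : (closedLVCat X).carrier) :
    (closedLVCat X).hom [closedMul f g] h = (closedLVCat X).hom [f] (closedRimp g h) :=
  (hom_closedMul f g h).trans (closed_hom_append_rimp [f] g h)

/-- Closed presheaves form a monoid. As `hom [f₁ ∗ … ∗ fₙ] g = hom [f₁, …, fₙ] g`, the laws
follow from the Yoneda lemma. -/
@[reducible]
def closedMonoid (X : LVCat V) : Monoid (closedLVCat X).carrier where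
  mul := closedMul
  one := closedOne X
  mul_assoc f g h := closed_eq_of_hom_eq fun k =>
    calc (closedLVCat X).hom [closedMul (closedMul f g) h] k
        = (closedLVCat X).hom [f, g] (closedRimp h k) := by
          rw [hom_closedMul_eq_rimp, hom_closedMul]
      _ = (closedLVCat X).hom [f, g, h] k := (closed_hom_append_rimp [f, g] h k).symm
      _ = (closedLVCat X).hom [g, h] (closedLimp f k) := closed_hom_cons_limp [g, h] f k
      _ = (closedLVCat X).hom [closedMul f (closedMul g h)] k := by
          rw [hom_closedMul_eq_limp f, hom_closedMul]
  one_mul f := closed_eq_of_hom_eq fun k =>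
    calc (closedLVCat X).hom [closedMul (closedOne X) f] k
        = (closedLVCat X).hom [] (closedRimp f k) := by
          rw [hom_closedMul_eq_rimp, hom_closedOne]
      _ = (closedLVCat X).hom [f] k := (closed_hom_append_rimp [] f k).symm
  mul_one f := closed_eq_of_hom_eq fun k =>
    calc (closedLVCat X).hom [closedMul f (closedOne X)] k
        = (closedLVCat X).hom [] (closedLimp f k) := by
          rw [hom_closedMul_eq_limp, hom_closedOne]
      _ = (closedLVCat X).hom [f] k := (closed_hom_cons_limp [] f k).symm

theorem one_le_hom_pair_closedMul (f g : (closedLVCat X).carrier) :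
    1 ≤ (closedLVCat X).hom [f, g] (closedMul f g) :=
  ((closedLVCat X).id_le _).trans (hom_closedMul f g _).le

theorem closedMul_functor (f f' g g' : (closedLVCat X).carrier) :
    (closedLVCat X).hom [f] f' * (closedLVCat X).hom [g] g' ≤
      (closedLVCat X).hom [closedMul f g] (closedMul f' g') := by
  rw [hom_closedMul]
  have h := (closedLVCat X).comp_le [[f], [g]] [f', g'] (closedMul f' g')
  simp only [listRel, mul_one] at h
  simpa using (mul_le_mul_right (one_le_hom_pair_closedMul f' g') _).trans h

/-- The colimit of closed presheaves is the closure of the pointwise one. -/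
theorem isCocomplete_closedLVCat : IsCocomplete (closedLVCat X).toVCat := by
  intro A Z j f hj hf
  have h : IsWeightedColimit (Y := (closedLVCat X).toVCat) j f
      (fun z => closedMk X fun w => ⨆ x, j x z * (f x).1.val w) := fun z g => by
    refine eq_of_forall_le_iff fun t => le_hom_closedMk_iff.trans (Iff.trans ?_ le_iInf_ihom.symm)
    have h1 : ∀ x, t * j x z ≤ (closedLVCat X).toVCat.hom (f x) g ↔
        ∀ w, t * j x z * (f x).1.val w ≤ g.1.val w := fun x => le_presheafHom_singleton_iff
    simp only [h1, Quantale.mul_iSup_distrib, iSup_le_iff, mul_assoc]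
    exact forall_comm
  exact ⟨_, h.isVFunctor hj, h⟩

/-- A map with a right adjoint is cocontinuous. -/
theorem isCocontinuous_of_rightAdjoint {Y : VCat V} {h r : Y.carrier → Y.carrier}
    (H : ∀ x y, Y.hom (h x) y = Y.hom x (r y)) : IsCocontinuous Y Y h := by
  intro A Z j f g _ _ _ hc z y
  simp only [Function.comp_apply, H]
  exact hc z (r y)

/-- The `V`-quantale of closed presheaves. -/
def closedQuantale (X : LVCat V) : VQuantale V where
  toVCat := (closedLVCat X).toVCat
  monoid := closedMonoid X
  mul_functor f g f' g' := closedMul_functor f f' g g'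
  separated := isSeparated_closedLVCat
  cocomplete := isCocomplete_closedLVCat
  cocontinuous_left f := isCocontinuous_of_rightAdjoint (hom_closedMul_eq_limp f)
  cocontinuous_right f :=
    isCocontinuous_of_rightAdjoint fun g => hom_closedMul_eq_rimp g f

theorem hom_prod_closedQuantale (l : List (closedQuantale X).carrier)
    (g : (closedQuantale X).carrier) :
    (closedQuantale X).hom l.prod g = (closedLVCat X).hom l g := by
  induction l generalizing g with
  | nil => exact hom_closedOne g
  | cons f l ih =>
    exact ((hom_closedMul_eq_limp f _ g).trans (ih (closedLimp f g))).trans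
      (closed_hom_cons_limp l f g).symm

theorem toLVCat_closedQuantale (X : LVCat V) : (closedQuantale X).toLVCat = closedLVCat X := by
  unfold VQuantale.toLVCat
  congr 1
  exact funext fun l => funext (hom_prod_closedQuantale l)

end ClosedQuantale

/-! ### Full subobjects of `𝔻_L(X)` that contain the Yoneda embedding -/

section Embedding

variable {V : Type u} [CommMonoid V] [CompleteLattice V] [IsQuantale V]

theorem listRel_mono {X Y : Type u} {r s : X → Y → V} (h : ∀ x y, r x y ≤ s x y)
    (xs : List X) (ys : List Y) : listRel r xs ys ≤ listRel s xs ys := by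
  induction xs generalizing ys with
  | nil => cases ys <;> rfl
  | cons x xs ih =>
    cases ys with
    | nil => rfl
    | cons y ys => exact mul_le_mul' (h x y) (ih ys)

theorem fullyFaithful_comp {X Y Z : LVCat V} {f : X ⟶ Y} {g : Y ⟶ Z} (hf : fullyFaithful V f)
    (hg : fullyFaithful V g) : fullyFaithful V (f ≫ g) := fun l x => by
  rw [hf l x, hg _ _, List.map_map]
  rfl

theorem fullyFaithful_of_comp {X Y Z : LVCat V} {f : X ⟶ Y} {g : Y ⟶ Z}
    (h : fullyFaithful V (f ≫ g)) : fullyFaithful V f := fun l x => by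
  refine le_antisymm (LVFunctor.map_le f l x) ?_
  rw [h l x]
  refine (LVFunctor.map_le g _ _).trans (le_of_eq ?_)
  rw [List.map_map]
  rfl

variable {X : LVCat V} {S : Presheaf X → Prop}

theorem presheafLimp_yonedaObj_val (x : X.carrier) (g : Presheaf X) (w : List X.carrier) :
    (presheafLimp (yonedaObj X x) g).val w = g.val (x :: w) := by
  rw [← presheafHom_map_yonedaObj, ← presheafHom_map_yonedaObj, List.map_cons,
    presheafHom_limp]

/-- The Yoneda lemma in all variables but one: multimorphisms `(u, f, v) → g`, with `u` and `v`
lists of representable presheaves, amount to inequalities `f(w) ≤ g(u; w; v)`. -/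
theorem le_presheafHom_insert_iff {t : V} {u v : List X.carrier} {f g : Presheaf X} :
    t ≤ presheafHom X (u.map (yonedaObj X) ++ [f] ++ v.map (yonedaObj X)) g ↔
      ∀ w, t * f.val w ≤ g.val (u ++ w ++ v) := by
  induction u generalizing g with
  | nil =>
    rw [List.map_nil, List.nil_append, List.singleton_append, presheafHom_limp,
      presheafHom_map_yonedaObj]
    exact le_iInf_ihom
  | cons x u ih =>
    rw [List.map_cons, List.cons_append, List.cons_append, presheafHom_limp, ih]
    simp only [presheafLimp_yonedaObj_val, List.cons_append]

/-- The Yoneda embedding, with values in a full subobject of `𝔻_L(X)`. -/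
def yonedaRestrict (hS : ∀ x, S (yonedaObj X x)) : X ⟶ (presheafLVCat X).restrict S :=
  LVFunctor.mk (X := X) (Y := (presheafLVCat X).restrict S) (fun x => ⟨yonedaObj X x, hS x⟩)
    fun l x => by
      refine (presheafHom_map_yonedaObj_yonedaObj l x).ge.trans (le_of_eq (Eq.symm ?_))
      exact congrArg (presheafHom X · (yonedaObj X x)) List.map_map

theorem map_val_map_yonedaRestrict (hS : ∀ x, S (yonedaObj X x)) (l : List X.carrier) :
    (l.map (LVFunctor.toFun (yonedaRestrict hS))).map Subtype.val = l.map (yonedaObj X) :=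
  List.map_map

theorem hom_map_yonedaRestrict (hS : ∀ x, S (yonedaObj X x)) (l : List X.carrier)
    (g : ((presheafLVCat X).restrict S).carrier) :
    ((presheafLVCat X).restrict S).hom (l.map (LVFunctor.toFun (yonedaRestrict hS))) g =
      g.1.val l := by
  refine Eq.trans ?_ (presheafHom_map_yonedaObj l g.1)
  exact congrArg (presheafHom X · g.1) (map_val_map_yonedaRestrict hS l)

theorem fullyFaithful_yonedaRestrict (hS : ∀ x, S (yonedaObj X x)) :
    fullyFaithful V (yonedaRestrict hS) :=
  fun l x => (hom_map_yonedaRestrict hS l ⟨yonedaObj X x, hS x⟩).symm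

/-- By density of the Yoneda embedding, a morphism out of a full subobject of `𝔻_L(X)` is fully
faithful as soon as it is so on homs whose sources are in the image of that embedding. -/
theorem fullyFaithful_of_yonedaRestrict (hS : ∀ x, S (yonedaObj X x)) {W : LVCat V}
    (F : (presheafLVCat X).restrict S ⟶ W)
    (h : ∀ g l, W.hom (l.map (LVFunctor.toFun (yonedaRestrict hS ≫ F))) (LVFunctor.toFun F g) ≤
      g.1.val l) : fullyFaithful V F := by
  intro fs g
  refine le_antisymm (LVFunctor.map_le F fs g) (le_presheafHom_iff.2 fun ls => ?_)
  have h1 : listRel (fun (f : Presheaf X) l => f.val l) (fs.map Subtype.val) ls ≤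
      listRel W.hom (ls.map (List.map (LVFunctor.toFun (yonedaRestrict hS ≫ F))))
        (fs.map (LVFunctor.toFun F)) := by
    have h2 := listRel_map (fun (f : Presheaf X) l => f.val l) Subtype.val id fs ls
    rw [List.map_id] at h2
    rw [listRel_map]
    refine h2.le.trans ((listRel_swap _ _ _).ge.trans (listRel_mono (fun l f => ?_) ls fs))
    refine (hom_map_yonedaRestrict hS l f).ge.trans ((LVFunctor.map_le F _ _).trans ?_)
    exact le_of_eq (congrArg (W.hom · (LVFunctor.toFun F f)) List.map_map)
  refine (mul_le_mul_right h1 _).trans ?_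
  rw [mul_comm]
  refine (W.comp_le _ _ _).trans (le_trans (le_of_eq ?_) (h g ls.flatten))
  rw [List.map_flatten]

end Embedding

/-! ### Essential extensions -/

section Essential

variable {V : Type u} [CommMonoid V] [CompleteLattice V] [IsQuantale V] {X : LVCat V}

/-- The Yoneda embedding into the closed presheaves is essential: the upper bounds of a closed
presheaf `g` are multimorphisms `(u, g, v) → x`, which any morphism of `(L,V)`-categories
preserves, and they determine `g`. -/
theorem fullyFaithful_of_comp_yoneda_closed {W : LVCat V} (F : closedLVCat X ⟶ W)
    (hF : fullyFaithful V (yonedaRestrict isClosed_yonedaObj ≫ F)) : fullyFaithful V F := by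
  refine fullyFaithful_of_yonedaRestrict isClosed_yonedaObj F fun g p => ?_
  refine Presheaf.isClosed_iff.1 g.2 _ _ fun u v x c hc => ?_
  set e : X ⟶ closedLVCat X := yonedaRestrict isClosed_yonedaObj
  -- The upper bound `c` of `g` is a multimorphism from `(u, g, v)` to `x`.
  have h1 : c ≤ (closedLVCat X).hom
      (u.map (LVFunctor.toFun e) ++ [g] ++ v.map (LVFunctor.toFun e)) (LVFunctor.toFun e x) := by
    refine ((le_presheafHom_insert_iff (g := yonedaObj X x)).2 hc).trans (le_of_eq (Eq.symm ?_))
    refine congrArg (presheafHom X · (yonedaObj X x)) (List.map_append.trans ?_)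
    exact congrArg₂ _ (List.map_append.trans
      (congrArg (· ++ [g.1]) (map_val_map_yonedaRestrict _ u))) (map_val_map_yonedaRestrict _ v)
  have h2 := h1.trans (LVFunctor.map_le F _ _)
  rw [List.map_append, List.map_append, List.map_map, List.map_map] at h2
  rw [hF]
  -- In `W`, compose its image with multimorphisms from `p` to the image of `g`.
  have h3 := W.listRel_mul_hom_le (u.map (LVFunctor.toFun (e ≫ F)))
    (v.map (LVFunctor.toFun (e ≫ F))) [p.map (LVFunctor.toFun (e ≫ F))] [LVFunctor.toFun F g]
    (LVFunctor.toFun (e ≫ F) x)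
  simp only [listRel, mul_one, List.flatten_cons, List.flatten_nil, List.append_nil] at h3
  rw [List.map_append, List.map_append]
  exact (mul_le_mul_right h2 _).trans h3

theorem yonedaGenerated_eq : yonedaGenerated X = yonedaRestrict Generated.yoneda :=
  rfl

/-- The Yoneda embedding into the generated algebra is essential, by induction on the generation:
evaluation `(f ▷ g, f) → g` is preserved by every morphism. -/
theorem fullyFaithful_of_comp_yonedaGenerated {W : LVCat V} (F : generatedAlgebra X ⟶ W)
    (hF : fullyFaithful V (yonedaGenerated X ≫ F)) : fullyFaithful V F := by
  rw [yonedaGenerated_eq] at hF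
  refine fullyFaithful_of_yonedaRestrict Generated.yoneda F fun ⟨g, hg⟩ => ?_
  let n : X.carrier → W.carrier := LVFunctor.toFun (yonedaRestrict Generated.yoneda ≫ F)
  let F' : (generatedAlgebra X).carrier → W.carrier := LVFunctor.toFun F
  -- By the Yoneda lemma, values of `f` are multihoms, so `F` bounds them.
  have key : ∀ (f : (generatedAlgebra X).carrier) l, f.1.val l ≤ W.hom
      (l.map (LVFunctor.toFun (yonedaRestrict Generated.yoneda ≫ F))) (LVFunctor.toFun F f) := by
    intro f l
    refine (hom_map_yonedaRestrict Generated.yoneda l f).ge.trans ?_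
    refine (LVFunctor.map_le F _ _).trans (le_of_eq ?_)
    exact congrArg (W.hom · (LVFunctor.toFun F f)) List.map_map
  induction hg with
  | yoneda x => exact fun l => (hF l x).ge
  | @rimp f g hf hg _ ih =>
    refine fun l => le_iInf_ihom.2 fun v => ?_
    have h1 : 1 ≤ (generatedAlgebra X).hom [⟨presheafRimp f g, hf.rimp hg⟩, ⟨f, hf⟩] ⟨g, hg⟩ :=
      ((presheafLVCat X).id_le _).trans (presheafHom_rimp [presheafRimp f g] f g).ge
    have h2 := W.comp_le [l.map n, v.map n]
      [F' ⟨presheafRimp f g, hf.rimp hg⟩, F' ⟨f, hf⟩] (F' ⟨g, hg⟩)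
    simp only [listRel, mul_one, List.flatten_cons, List.flatten_nil, List.append_nil,
      ← List.map_append] at h2
    refine le_trans ?_ (h2.trans (ih (l ++ v)))
    refine (mul_one _).ge.trans (mul_le_mul' ?_ (h1.trans (LVFunctor.map_le F _ _)))
    exact mul_le_mul_right (key ⟨f, hf⟩ v) _
  | @limp f g hf hg _ ih =>
    refine fun l => le_iInf_ihom.2 fun v => ?_
    have h1 : 1 ≤ (generatedAlgebra X).hom [⟨f, hf⟩, ⟨presheafLimp f g, hf.limp hg⟩] ⟨g, hg⟩ :=
      ((presheafLVCat X).id_le _).trans (presheafHom_limp [presheafLimp f g] f g).ge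
    have h2 := W.comp_le [v.map n, l.map n]
      [F' ⟨f, hf⟩, F' ⟨presheafLimp f g, hf.limp hg⟩] (F' ⟨g, hg⟩)
    simp only [listRel, mul_one, List.flatten_cons, List.flatten_nil, List.append_nil,
      ← List.map_append] at h2
    refine le_trans ?_ (h2.trans (ih (v ++ l)))
    refine (mul_one _).ge.trans (mul_le_mul' ?_ (h1.trans (LVFunctor.map_le F _ _)))
    rw [mul_comm]
    exact mul_le_mul_left (key ⟨f, hf⟩ v) _

theorem isPrequantumBAlgebra_generatedAlgebra (X : LVCat V) :
    IsPrequantumBAlgebra (generatedAlgebra X) := by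
  refine isPrequantumBAlgebra_of_residuated _ (fun f g => ?_) fun f g => ?_
  · refine ⟨⟨presheafRimp f.1 g.1, f.2.rimp g.2⟩, fun l => ?_⟩
    refine Eq.trans ?_ (presheafHom_rimp (l.map Subtype.val) f.1 g.1)
    exact congrArg (presheafHom X · g.1) List.map_append
  · exact ⟨⟨presheafLimp f.1 g.1, f.2.limp g.2⟩,
      fun l => presheafHom_limp (l.map Subtype.val) f.1 g.1⟩

end Essential

/-! ### Injective hulls -/

section InjectiveHulls

set_option linter.unusedSectionVars false

variable {V : Type u} [CommMonoid V] [CompleteLattice V] [IsQuantale V]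

theorem mem_closedLVCat {C : ObjectProperty (LVCat V)} (hC : ∀ Q : VQuantale V, C Q.toLVCat)
    (X : LVCat V) : C (closedLVCat X) :=
  toLVCat_closedQuantale X ▸ hC (closedQuantale X)

theorem isInjectiveHull_closedLVCat {C : ObjectProperty (LVCat V)}
    (hC : ∀ Q : VQuantale V, C Q.toLVCat) (X : LVCat V) (hX : C X) :
    IsInjectiveHull (fullyFaithfulIn C)
      (ObjectProperty.homMk (yonedaRestrict isClosed_yonedaObj) :
        (⟨X, hX⟩ : C.FullSubcategory) ⟶ ⟨closedLVCat X, mem_closedLVCat hC X⟩) :=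
  ⟨fullyFaithful_yonedaRestrict _,
    (closedQuantale X).isInjective (toLVCat_closedQuantale X).symm,
    fun _ f hf => fullyFaithful_of_comp_yoneda_closed f.hom hf⟩

/-- The categorical part of the uniqueness of injective hulls: from one hull of `Y` to another
there is a split epimorphism `k` in the class `J`. For fully faithful functors this makes `k` an
isomorphism when `E'` is separated. -/
theorem IsInjectiveHull.exists_retraction {𝒞 : Type*} [Category 𝒞] {J : MorphismProperty 𝒞}
    {Y E E' : 𝒞} {e : Y ⟶ E} {e' : Y ⟶ E'} (he : IsInjectiveHull J e)
    (he' : IsInjectiveHull J e') : ∃ (h : E ⟶ E') (k : E' ⟶ E), h ≫ k = 𝟙 E ∧ J k := by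
  obtain ⟨h, hh⟩ := he'.2.1 e e' he.1
  obtain ⟨k, hk⟩ := he.2.1 h (𝟙 E) (he.2.2 h (hh ▸ he'.1))
  refine ⟨h, k, hk, he'.2.2 k ?_⟩
  rw [← hh, Category.assoc, hk, Category.comp_id]
  exact he.1

theorem IsWeightedColimit.equiv {A Z Y Y' : VCat V} (φ : Y.carrier ≃ Y'.carrier)
    (hφ : ∀ x y, Y.hom x y = Y'.hom (φ x) (φ y)) {j : A.carrier → Z.carrier → V}
    {f : A.carrier → Y.carrier} {g : Z.carrier → Y.carrier} :
    IsWeightedColimit (Y := Y') j (φ ∘ f) (φ ∘ g) ↔ IsWeightedColimit j f g := by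
  refine forall_congr' fun z => φ.symm.forall_congr fun y => ?_
  simp [hφ]

/-- Transport of structure: an `(L,V)`-category isomorphic to a `V`-quantale is equal to one, as
the multiplication can be transported along the bijection `φ`. -/
theorem VQuantale.exists_eq_toLVCat (Q : VQuantale V) {E : LVCat V} (φ : E.carrier ≃ Q.carrier)
    (hφ : ∀ l y, E.hom l y = Q.hom (l.map φ).prod (φ y)) :
    ∃ Q' : VQuantale V, E = Q'.toLVCat := by
  have hφ₁ : ∀ x y, E.toVCat.hom x y = Q.toVCat.hom (φ x) (φ y) := fun x y =>
    (hφ [x] y).trans (congrArg (Q.hom · (φ y)) (mul_one (φ x)))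
  have hfun : ∀ {A : VCat V} {f : A.carrier → E.carrier}, IsVFunctor A E.toVCat f →
      IsVFunctor A Q.toVCat (φ ∘ f) := fun hf x x' => (hf x x').trans (hφ₁ _ _).le
  let M : Monoid E.carrier := φ.monoid
  have hmul : ∀ x y, φ (x * y) = φ x * φ y := map_mul φ.mulEquiv
  have hcont : ∀ {h : E.carrier → E.carrier} {h' : Q.carrier → Q.carrier},
      (∀ x, φ (h x) = h' (φ x)) → IsCocontinuous Q.toVCat Q.toVCat h' →
      IsCocontinuous E.toVCat E.toVCat h := by
    intro h h' hh hc A Z j f g hj hf hg hcol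
    refine (IsWeightedColimit.equiv (Y := E.toVCat) (Y' := Q.toVCat) φ hφ₁).1 ?_
    have := hc A Z j (φ ∘ f) (φ ∘ g) hj (hfun hf) (hfun hg)
      ((IsWeightedColimit.equiv (Y := E.toVCat) (Y' := Q.toVCat) φ hφ₁).2 hcol)
    convert this using 1
    · exact funext fun x => hh _
    · exact funext fun x => hh _
  let Q' : VQuantale V :=
    { toVCat := E.toVCat
      monoid := M
      mul_functor := fun x x' y y' => by
        rw [hφ₁, hφ₁, hφ₁]
        refine (Q.mul_functor _ _ _ _).trans (le_of_eq ?_)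
        exact congrArg₂ Q.hom (hmul x x').symm (hmul y y').symm
      separated := fun x y h h' => φ.injective
        (Q.separated _ _ (h.trans (hφ₁ _ _).le) (h'.trans (hφ₁ _ _).le))
      cocomplete := fun A Z j f hj hf => by
        obtain ⟨g, -, hg⟩ := Q.cocomplete A Z j (φ ∘ f) hj (hfun hf)
        have h : IsWeightedColimit (Y := E.toVCat) j f (φ.symm ∘ g) := by
          refine (IsWeightedColimit.equiv (Y := E.toVCat) (Y' := Q.toVCat) φ hφ₁).1 ?_
          have h1 : φ ∘ φ.symm ∘ g = g := funext fun z => φ.apply_symm_apply _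
          rwa [h1]
        exact ⟨_, h.isVFunctor hj, h⟩
      cocontinuous_left := fun q => hcont (hmul q) (Q.cocontinuous_left (φ q))
      cocontinuous_right := fun q => hcont (fun x => hmul x q) (Q.cocontinuous_right (φ q)) }
  refine ⟨Q', ?_⟩
  have hprod : ∀ l y, E.hom l y = E.hom [l.prod] y := fun l y => by
    refine (hφ l y).trans (Eq.trans ?_ (hφ₁ l.prod y).symm)
    exact congrArg (Q.hom · (φ y)) (map_list_prod φ.mulEquiv l).symm
  change E = LVCat.mk E.carrier (fun l y => E.hom [l.prod] y) _ _
  obtain ⟨K, a, h1, h2⟩ := E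
  congr 1
  exact funext fun l => funext (hprod l)

/-- An injective hull, in a full subcategory that contains all `V`-quantales, is a
`V`-quantale. -/
theorem IsInjectiveHull.exists_eq_toLVCat {C : ObjectProperty (LVCat V)}
    (hC : ∀ Q : VQuantale V, C Q.toLVCat) {Y E : C.FullSubcategory} {e : Y ⟶ E}
    (he : IsInjectiveHull (fullyFaithfulIn C) e) : ∃ Q : VQuantale V, E.obj = Q.toLVCat := by
  obtain ⟨h, k, hk, hff⟩ := he.exists_retraction
    (isInjectiveHull_closedLVCat hC Y.obj Y.property)
  let k' : (closedLVCat Y.obj).carrier → E.obj.carrier := LVFunctor.toFun k.hom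
  have hk' : ∀ l y, (closedLVCat Y.obj).hom l y = E.obj.hom (l.map k') (k' y) := hff
  -- `k` is surjective as a split epimorphism, and injective because it is fully faithful and its
  -- source is separated.
  have hbij : Function.Bijective k' := by
    refine ⟨fun p q hpq => isSeparated_closedLVCat p q ?_ ?_,
      fun y => ⟨LVFunctor.toFun h.hom y, ?_⟩⟩
    · exact (((closedLVCat Y.obj).id_le q).trans (hk' [q] q).le).trans
        (le_of_eq (by simp only [List.map_cons, List.map_nil, ← hpq])) |>.trans (hk' [p] q).ge
    · exact (((closedLVCat Y.obj).id_le p).trans (hk' [p] p).le).trans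
        (le_of_eq (by simp only [List.map_cons, List.map_nil, ← hpq])) |>.trans (hk' [q] p).ge
    · exact congrFun (congrArg (fun m : E ⟶ E => LVFunctor.toFun m.hom) hk) y
  let φ := Equiv.ofBijective k' hbij
  have hφ : ∀ l y, E.obj.hom l y = (closedLVCat Y.obj).hom (l.map φ.symm) (φ.symm y) := by
    intro l y
    rw [hk', List.map_map]
    have h1 : k' ∘ φ.symm = id := funext φ.apply_symm_apply
    rw [h1, List.map_id]
    exact congrArg (E.obj.hom l) (φ.apply_symm_apply y).symm
  refine (closedQuantale Y.obj).exists_eq_toLVCat φ.symm fun l y => (hφ l y).trans ?_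
  exact (hom_prod_closedQuantale _ _).symm

end InjectiveHulls

end LV

open LV

theorem mainTheorem1 {V : Type u} [CommMonoid V] [CompleteLattice V] [IsQuantale V]
    (C : ObjectProperty (LVCat V)) (hC : ∀ Q : VQuantale V, C Q.toLVCat)
    (X : LVCat V) (hX : C X) :
    (∃ (E : C.FullSubcategory) (e : (⟨X, hX⟩ : C.FullSubcategory) ⟶ E),
        IsInjectiveHull (fullyFaithfulIn C) e) ∧
    ∃ hA : IsPrequantumBAlgebra (generatedAlgebra X),
      (∃ (E : (IsPrequantumBAlgebra (V := V)).FullSubcategory)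
          (e : (⟨generatedAlgebra X, hA⟩ :
            (IsPrequantumBAlgebra (V := V)).FullSubcategory) ⟶ E),
        IsInjectiveHull (fullyFaithfulIn IsPrequantumBAlgebra) e) ∧
      ∀ (E : (IsPrequantumBAlgebra (V := V)).FullSubcategory)
          (e : (⟨generatedAlgebra X, hA⟩ :
            (IsPrequantumBAlgebra (V := V)).FullSubcategory) ⟶ E),
        IsInjectiveHull (fullyFaithfulIn IsPrequantumBAlgebra) e →
          ∃ hE : C E.obj,
            IsInjectiveHull (fullyFaithfulIn C)
              (ObjectProperty.homMk (yonedaGenerated X ≫ e.hom) :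
                (⟨X, hX⟩ : C.FullSubcategory) ⟶ ⟨E.obj, hE⟩) := by
  have hB : ∀ Q : VQuantale V, IsPrequantumBAlgebra Q.toLVCat := VQuantale.isPrequantumBAlgebra
  refine ⟨⟨_, _, isInjectiveHull_closedLVCat hC X hX⟩, isPrequantumBAlgebra_generatedAlgebra X,
    ⟨_, _, isInjectiveHull_closedLVCat hB _ _⟩, fun E e he => ?_⟩
  obtain ⟨Q, hQ⟩ := he.exists_eq_toLVCat hB
  refine ⟨hQ ▸ hC Q, fullyFaithful_comp (fullyFaithful_yonedaRestrict _) he.1,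
    Q.isInjective hQ, fun W f hf => ?_⟩
  -- The target `W` need not be a prequantum B-algebra, but it embeds into a `V`-quantale.
  let i := yonedaRestrict (X := W.obj) isClosed_yonedaObj
  let f' : E ⟶ ⟨closedLVCat W.obj, mem_closedLVCat hB W.obj⟩ :=
    ObjectProperty.homMk (f.hom ≫ i)
  have h1 : fullyFaithful V (e.hom ≫ f.hom) := fullyFaithful_of_comp_yonedaGenerated _ hf
  have h2 : fullyFaithful V ((e.hom ≫ f.hom) ≫ i) :=
    fullyFaithful_comp h1 (fullyFaithful_yonedaRestrict _)
  exact fullyFaithful_of_comp (he.2.2 f' h2)
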